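/- Let $\mathbb{U}$ be the (separable) Urysohn space, i.e. the complete separable metric space, unique up to isometry, such that every isometry between finite subspaces of $\mathbb{U}$ extends to an isometry of $\mathbb{U}$ onto itself, and every complete separable metric space embeds isometrically in $\mathbb{U}$. Let $\mathbb{S}$ be the Urysohn sphere, i.e. the complete separable metric space of diameter at most $1$, unique up to isometry, such that every isometry between finite subspaces of $\mathbb{S}$ extends to an isometry of $\mathbb{S}$ onto itself, and every complete separable metric space of diameter at most $1$ embeds isometrically in $\mathbb{S}$. For a metric space $(X,d)$ let $\mathcal{F}(X)$ be the set of all non-empty closed subsets of $X$ with the Wijsman topology, the weakest topology for which all the functions $F\mapsto d(x,F)=\inf_{y\in F}d(x,y)$, $x\in X$, are continuous; give $\mathcal{F}(X)^2$ the product topology. For $A,B\in\mathcal{F}(X)$ let $\mathrm{Iso}(A,B)$ be the set of isometries of $A$ onto $B$ with the topology of pointwise convergence, and $\mathrm{Iso}(A)=\mathrm{Iso}(A,A)$. A property holds for a generic element of a topological space if the set of elements having it is comeager. Let $X=\mathbb{U}$ or $X=\mathbb{S}$. Then: 1. For a generic $F\in\mathcal{F}(X)$, the generic isometry $f\in\mathrm{Iso}(F)$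 cannot be extended to an isometry $\tilde f\in\mathrm{Iso}(X)$. 2. For a generic pair $(A,B)\in\mathcal{F}(X)^2$, the spaces $A$ and $B$ are isometric, and the generic isometry $f\in\mathrm{Iso}(A,B)$ cannot be extended to an isometry $\tilde f\in\mathrm{Iso}(X)$. -/

import Mathlib

universe u

namespace UrysohnGeneric

/-- Every isometry between finite subspaces of `X` extends to an isometry of `X` onto itself. -/
def IsUltrahomogeneous (X : Type u) [MetricSpace X] : Prop :=
  ∀ (A B : Set X), A.Finite → B.Finite → ∀ f : A ≃ᵢ B,
    ∃ φ : X ≃ᵢ X, ∀ a : A, φ a = f a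

/-- `X` is (isometric to) the separable Urysohn space: the Polish metric space that is
ultrahomogeneous and contains an isometric copy of every Polish metric space. -/
structure IsUrysohnSpace (X : Type u) [MetricSpace X] : Prop where
  complete : CompleteSpace X
  separable : TopologicalSpace.SeparableSpace X
  ultrahomogeneous : IsUltrahomogeneous X
  universal : ∀ (Y : Type u) [MetricSpace Y] [CompleteSpace Y]
    [TopologicalSpace.SeparableSpace Y], ∃ e : Y → X, Isometry e

/-- `X` is (isometric to) the Urysohn sphere: the Polish metric space of diameter at most `1`
that is ultrahomogeneous and contains an isometric copy of every Polish metric space of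
diameter at most `1`. -/
structure IsUrysohnSphere (X : Type u) [MetricSpace X] : Prop where
  complete : CompleteSpace X
  separable : TopologicalSpace.SeparableSpace X
  dist_le_one : ∀ x y : X, dist x y ≤ 1
  ultrahomogeneous : IsUltrahomogeneous X
  universal : ∀ (Y : Type u) [MetricSpace Y] [CompleteSpace Y]
    [TopologicalSpace.SeparableSpace Y], (∀ x y : Y, dist x y ≤ 1) → ∃ e : Y → X, Isometry e

/-- The hyperspace of all (nonempty) closed subsets of `X`. Nonemptiness is what makes the
distance functionals `F ↦ d(x, F)` real-valued. -/
structure Hyperspace (X : Type u) [MetricSpace X] where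
  carrier : Set X
  isClosed_carrier : IsClosed carrier
  nonempty_carrier : carrier.Nonempty

/-- The Wijsman topology: the weakest topology making every distance functional
`F ↦ d(x, F)` continuous. -/
noncomputable instance Hyperspace.wijsmanTopology (X : Type u) [MetricSpace X] :
    TopologicalSpace (Hyperspace X) :=
  ⨅ x : X, TopologicalSpace.induced
    (fun F : Hyperspace X => Metric.infDist x F.carrier) inferInstance

/-- The topology of pointwise convergence on the space `Iso(A, B)` of surjective isometries. -/
instance isoPointwiseTopology (A B : Type u) [MetricSpace A] [MetricSpace B] :
    TopologicalSpace (A ≃ᵢ B) :=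
  TopologicalSpace.induced (fun f : A ≃ᵢ B => (f : A → B)) inferInstance

/-- The isometry `f : A → B` between subspaces of `X` extends to an isometry of `X` onto `X`. -/
def Extends {X : Type u} [MetricSpace X] {A B : Set X} (f : A ≃ᵢ B) : Prop :=
  ∃ φ : X ≃ᵢ X, ∀ a : A, φ a = f a

end UrysohnGeneric

/-! Let `J` be the whole line for the Urysohn space and `Iic 1` for the sphere; only that `J` is a
lower set containing 1 matters, so both cases are one. In `X` every `J`-valued Katetov function on
finitely many points is realized.

A generic `F` approximately realizes every Katetov function over finitely many points of `X`, not
just of `F`, whose values strictly exceed the distances to `F` (`eventually_isRelativelyUrysohn`):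
adding a suitable realizing point to `F` does not change its distances to the finitely many points
defining a Wijsman neighbourhood. Over points of `F` itself this makes `F` a Urysohn space
(`IsRelativelyUrysohn.urysohnLike`), so by back-and-forth two generic sets are isometric and finite
partial isometries of `F` extend to `F`. Still, generically some `x` has `0 < δ = d(x, F) < 1/2`.

For such an `x`, and any finite `s ⊆ F`, there are `a, b ∈ F` with the same distances to `s` while
`d(x, a)` and `d(x, b)` differ by more than `δ/2` (`IsRelativelyUrysohn.exists_dist_ne`). If `φ`
extends `f`, then `y = φ x` satisfies `d(y, f a) = d(x, a)` for all `a`. For fixed `y`, the `f`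
satisfying this up to `δ/4` form a closed set, with empty interior because `f` may be precomposed
with an isometry of `F` fixing `s` and taking `b` to `a`. Countably many `y` suffice
(`eventually_not_extends`). -/

namespace UrysohnGeneric

open Set Filter Topology

/-! ### Katetov functions and their truncated extensions -/

section Katetov

variable {ι κ Y : Type*} [MetricSpace Y]

/-- `f i` is a consistent choice of distances from a new point to the points `p i`. -/
def IsKatetov (p : ι → Y) (f : ι → ℝ) : Prop :=
  ∀ i j, f i ≤ f j + dist (p i) (p j) ∧ dist (p i) (p j) ≤ f i + f j

lemma IsKatetov.nonneg {p : ι → Y} {f : ι → ℝ} (h : IsKatetov p f) (i : ι) : 0 ≤ f i := by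
  have := (h i i).2
  rw [dist_self] at this
  linarith

lemma IsKatetov.comp {p : ι → Y} {f : ι → ℝ} (h : IsKatetov p f) (e : κ → ι) :
    IsKatetov (p ∘ e) (f ∘ e) := fun i j => h (e i) (e j)

lemma IsKatetov.option {p : ι → Y} {f : ι → ℝ} (h : IsKatetov p f) {y : Y} {c : ℝ} (hc : 0 ≤ c)
    (h₁ : ∀ i, f i ≤ c + dist (p i) y) (h₂ : ∀ i, c ≤ f i + dist (p i) y)
    (h₃ : ∀ i, dist (p i) y ≤ f i + c) :
    IsKatetov (fun o : Option ι => o.elim y p) (fun o => o.elim c f) := by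
  rintro (_ | i) (_ | j)
  · simpa using hc
  · simpa [dist_comm y, add_comm c] using ⟨h₂ j, h₃ j⟩
  · simpa using ⟨h₁ i, h₃ i⟩
  · simpa using h i j

/-- The largest extension of `f` to a Katetov function bounded by `M`. -/
noncomputable def katetovExt (p : ι → Y) (f : ι → ℝ) (M : ℝ) (y : Y) : ℝ :=
  ⨅ o : Option ι, o.elim M (fun i => f i + dist (p i) y)

lemma le_katetovExt {p : ι → Y} {f : ι → ℝ} {M c : ℝ} {y : Y} (hM : c ≤ M) (h : ∀ i, c ≤ f i + dist (p i) y) :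
    c ≤ katetovExt p f M y :=
  le_ciInf fun o => by cases o with
    | none => exact hM
    | some i => exact h i

variable [Finite ι] {p : ι → Y} {f : ι → ℝ} {M : ℝ}

lemma katetovExt_le_bound (y : Y) : katetovExt p f M y ≤ M :=
  ciInf_le (f := fun o : Option ι => o.elim M (fun i => f i + dist (p i) y))
    (finite_range _).bddBelow none

lemma katetovExt_le (y : Y) (i : ι) : katetovExt p f M y ≤ f i + dist (p i) y :=
  ciInf_le (f := fun o : Option ι => o.elim M (fun i => f i + dist (p i) y))
    (finite_range _).bddBelow (some i)

lemma katetovExt_apply (h : IsKatetov p f) {i : ι} (hM : f i ≤ M) :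
    katetovExt p f M (p i) = f i := by
  refine le_antisymm ((katetovExt_le _ i).trans (by simp)) (le_katetovExt hM fun j => ?_)
  rw [dist_comm]
  exact (h i j).1

/-- The cap `M` keeps the values in a lower set containing `M`. It does not spoil the lower bound on
sums of two values because `M` bounds the distances between the new points. -/
lemma isKatetov_katetovExt (h : IsKatetov p f) (hM0 : 0 ≤ M) (q : κ → Y)
    (hM : ∀ j k, dist (q j) (q k) ≤ M) : IsKatetov q fun j => katetovExt p f M (q j) := by
  have h0 : ∀ y, 0 ≤ katetovExt p f M y := fun y =>
    le_katetovExt hM0 fun i => add_nonneg (h.nonneg i) dist_nonneg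
  intro j k
  constructor
  · rw [← sub_le_iff_le_add]
    refine le_katetovExt ?_ fun i => ?_
    · linarith [katetovExt_le_bound (p := p) (f := f) (M := M) (q j),
        dist_nonneg (x := q j) (y := q k)]
    · linarith [katetovExt_le (p := p) (f := f) (M := M) (q j) i,
        dist_triangle (p i) (q k) (q j), dist_comm (q j) (q k)]
  · rw [← sub_le_iff_le_add]
    refine le_katetovExt ?_ fun i => ?_
    · linarith [h0 (q k), hM j k]
    · suffices dist (q j) (q k) - (f i + dist (p i) (q j)) ≤ katetovExt p f M (q k) by linarith
      refine le_katetovExt ?_ fun l => ?_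
      · linarith [hM j k, h.nonneg i, dist_nonneg (x := p i) (y := q j)]
      · linarith [(h i l).2, dist_triangle4 (q j) (p i) (p l) (q k), dist_comm (q j) (p i)]

end Katetov

/-! ### The one-point extension property -/

/-- All distances of `Y` lie in `J`, and every `J`-valued Katetov function on a finite family of
points of `Y` is realized by a point of `Y`. -/
structure UrysohnLike (J : Set ℝ) (Y : Type*) [MetricSpace Y] : Prop where
  dist_mem : ∀ x y : Y, dist x y ∈ J
  exists_dist_eq_fin : ∀ (n : ℕ) (p : Fin n → Y) (f : Fin n → ℝ), IsKatetov p f → (∀ i, f i ∈ J) →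
    ∃ y, ∀ i, dist y (p i) = f i

lemma UrysohnLike.exists_dist_eq {J : Set ℝ} {Y : Type*} [MetricSpace Y] (h : UrysohnLike J Y)
    {ι : Type*} [Finite ι] (p : ι → Y) (f : ι → ℝ) (hf : IsKatetov p f) (hJ : ∀ i, f i ∈ J) :
    ∃ y, ∀ i, dist y (p i) = f i := by
  obtain ⟨n, ⟨e⟩⟩ := Finite.exists_equiv_fin ι
  obtain ⟨y, hy⟩ := h.exists_dist_eq_fin n (p ∘ e.symm) (f ∘ e.symm) (hf.comp _) fun i => hJ _
  exact ⟨y, fun i => by simpa using hy (e i)⟩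

lemma exists_mem_forall_le {ι : Type*} [Finite ι] {J : Set ℝ} (h1 : 1 ∈ J) (v : ι → ℝ)
    (hv : ∀ i, v i ∈ J) : ∃ M ∈ J, 1 ≤ M ∧ ∀ i, v i ≤ M := by
  obtain ⟨o, ho⟩ := Finite.exists_max fun o : Option ι => o.elim 1 v
  refine ⟨o.elim 1 v, ?_, ho none, fun i => ho (some i)⟩
  cases o with
  | none => exact h1
  | some i => exact hv i

/-- The one-point extension of a metric space with prescribed distances to the new point. -/
@[reducible]
def optionMetricSpace {T : Type*} [MetricSpace T] (g : T → ℝ) (hg : IsKatetov id g)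
    (hpos : ∀ x, 0 < g x) : MetricSpace (Option T) where
  dist
    | none, none => 0
    | none, some y => g y
    | some x, none => g x
    | some x, some y => dist x y
  dist_self := by rintro (_ | x) <;> simp
  dist_comm := by rintro (_ | x) (_ | y) <;> simp [dist_comm]
  dist_triangle := by
    rintro (_ | x) (_ | y) (_ | z)
    · simp
    · simp
    · simpa using (hpos y).le
    · have := (hg z y).1
      simp only [id] at this
      simpa [dist_comm y z] using this
    · simp
    · simpa using (hg x z).2
    · have := (hg x y).1
      simp only [id] at this
      simpa [add_comm] using this
    · simpa using dist_triangle x y z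
  eq_of_dist_eq_zero := by
    rintro (_ | x) (_ | y) h
    · rfl
    · exact absurd h (hpos y).ne'
    · exact absurd h (hpos x).ne'
    · exact congrArg some (eq_of_dist_eq_zero h)

lemma urysohnLike_of_universal {J : Set ℝ} {X : Type u} [MetricSpace X]
    (h0J : 0 ∈ J) (hd : ∀ x y : X, dist x y ∈ J) (hX : IsUltrahomogeneous X)
    (hu : ∀ (Y : Type u) [MetricSpace Y] [CompleteSpace Y] [TopologicalSpace.SeparableSpace Y],
      (∀ x y : Y, dist x y ∈ J) → ∃ e : Y → X, Isometry e) : UrysohnLike J X := by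
  refine ⟨hd, fun n p f hf hJ => ?_⟩
  -- A zero value forces the new point to be `p i`; otherwise the one-point extension is a genuine
  -- metric space, and ultrahomogeneity moves its copy in `X` onto `p`.
  by_cases h0 : ∃ i, f i = 0
  · obtain ⟨i, hi⟩ := h0
    refine ⟨p i, fun j => le_antisymm ?_ ?_⟩
    · simpa [hi] using (hf i j).2
    · simpa [hi, dist_comm] using (hf j i).1
  have hpos : ∀ i, 0 < f i := fun i => (hf.nonneg i).lt_of_ne fun h => h0 ⟨i, h.symm⟩
  choose k hk using fun x : range p => x.2
  have hg : IsKatetov (id : range p → range p) (f ∘ k) := by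
    intro x y
    have := hf (k x) (k y)
    rwa [hk, hk] at this
  let _ : MetricSpace (Option (range p)) := optionMetricSpace (f ∘ k) hg fun x => hpos _
  obtain ⟨e, he⟩ := hu (Option (range p)) (by
    rintro (_ | x) (_ | y)
    · exact h0J
    · exact hJ _
    · exact hJ _
    · exact hd x y)
  have he' : Isometry fun x : range p => e (some x) := Isometry.of_dist_eq fun x y => he.dist_eq _ _
  obtain ⟨φ, hφ⟩ := hX _ _ (finite_range _) (finite_range _) he'.isometryEquivOnRange.symm
  refine ⟨φ (e none), fun i => ?_⟩
  have h1 : φ (e (some ⟨p i, mem_range_self i⟩)) = p i := by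
    have := hφ (he'.isometryEquivOnRange ⟨p i, mem_range_self i⟩)
    rw [IsometryEquiv.symm_apply_apply] at this
    exact this
  have h2 : f (k ⟨p i, mem_range_self i⟩) = f i := by
    have h3 := (hf i (k ⟨p i, mem_range_self i⟩)).1
    have h4 := (hf (k ⟨p i, mem_range_self i⟩) i).1
    rw [hk, dist_self] at h3 h4
    linarith
  calc dist (φ (e none)) (p i)
      = dist (φ (e none)) (φ (e (some ⟨p i, mem_range_self i⟩))) := by rw [h1]
    _ = dist none (some (⟨p i, mem_range_self i⟩ : range p)) := by rw [φ.dist_eq, he.dist_eq]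
    _ = f i := h2

/-! ### Isometries as closures of dense distance-preserving relations -/

section BackAndForth

/-- A relation between metric spaces that preserves distances. -/
def IsIsometricRel {A B : Type*} [MetricSpace A] [MetricSpace B] (R : Set (A × B)) : Prop :=
  ∀ ⦃z : A × B⦄, z ∈ R → ∀ ⦃w : A × B⦄, w ∈ R → dist z.1 w.1 = dist z.2 w.2

variable {A B : Type*} [MetricSpace A] [MetricSpace B] {R : Set (A × B)}

lemma IsIsometricRel.swap (h : IsIsometricRel R) : IsIsometricRel (Prod.swap ⁻¹' R) :=
  fun _ hz _ hw => (h hz hw).symm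

lemma IsIsometricRel.isIsometricRel_closure (h : IsIsometricRel R) : IsIsometricRel (closure R) := by
  intro z hz w hw
  have hc : IsClosed {v : (A × B) × (A × B) | dist v.1.1 v.2.1 = dist v.1.2 v.2.2} :=
    isClosed_eq (by fun_prop) (by fun_prop)
  have hsub : closure (R ×ˢ R) ⊆ {v : (A × B) × (A × B) | dist v.1.1 v.2.1 = dist v.1.2 v.2.2} :=
    closure_minimal (fun v hv => h hv.1 hv.2) hc
  rw [closure_prod_eq] at hsub
  exact hsub (show (z, w) ∈ _ from ⟨hz, hw⟩)

lemma IsIsometricRel.exists_mem_closure [CompleteSpace B] (h : IsIsometricRel R)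
    (hd : Dense (Prod.fst '' R)) (a : A) : ∃ b, (a, b) ∈ closure R := by
  obtain ⟨s, hs, hsa⟩ := mem_closure_iff_seq_limit.1 (hd a)
  choose z hz hzs using hs
  have hc : CauchySeq fun n => (z n).2 := by
    have := hsa.cauchySeq
    rw [Metric.cauchySeq_iff] at this ⊢
    intro ε hε
    obtain ⟨N, hN⟩ := this ε hε
    refine ⟨N, fun m hm n hn => ?_⟩
    rw [← h (hz m) (hz n), hzs, hzs]
    exact hN m hm n hn
  obtain ⟨b, hb⟩ := cauchySeq_tendsto_of_complete hc
  refine ⟨b, mem_closure_of_tendsto (f := z) (b := atTop) ?_ (Eventually.of_forall hz)⟩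
  have ha : Tendsto (fun n => (z n).1) atTop (𝓝 a) := by simpa only [hzs] using hsa
  exact ha.prodMk_nhds hb

lemma IsIsometricRel.exists_isometryEquiv [CompleteSpace A] [CompleteSpace B]
    (h : IsIsometricRel R) (hA : Dense (Prod.fst '' R)) (hB : Dense (Prod.snd '' R)) :
    ∃ e : A ≃ᵢ B, ∀ z ∈ R, e z.1 = z.2 := by
  have hB' : Dense (Prod.fst '' (Prod.swap ⁻¹' R)) := by
    convert hB using 1
    ext b
    simp
  choose f hf using h.exists_mem_closure hA
  choose g hg using h.swap.exists_mem_closure hB'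
  have hg' : ∀ b, (g b, b) ∈ closure R := fun b =>
    map_mem_closure (f := Prod.swap) continuous_swap (hg b) fun z hz => hz
  refine ⟨IsometryEquiv.mk' f g (fun b => ?_) (Isometry.of_dist_eq fun x y => ?_), fun z hz => ?_⟩
  · rw [← dist_eq_zero, ← h.isIsometricRel_closure (hf (g b)) (hg' b), dist_self]
  · exact (h.isIsometricRel_closure (hf x) (hf y)).symm
  · change f z.1 = z.2
    rw [← dist_eq_zero, ← h.isIsometricRel_closure (hf z.1) (subset_closure hz), dist_self]

end BackAndForth

/-! ### Back-and-forth -/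

section Extension

variable {A B : Type*} [MetricSpace A] [MetricSpace B] {J : Set ℝ}

/-- Finite distance-preserving relations, ordered by inclusion. -/
abbrev PartialIsometry (A B : Type*) [MetricSpace A] [MetricSpace B] : Type _ :=
  {R : Finset (A × B) // IsIsometricRel (R : Set (A × B))}

open Classical in
/-- The inverse of a finite partial isometry. -/
noncomputable def PartialIsometry.swap (R : PartialIsometry A B) : PartialIsometry B A :=
  ⟨R.1.image Prod.swap, fun z hz w hw => by
    simp only [Finset.coe_image, mem_image, Finset.mem_coe] at hz hw
    obtain ⟨z, hz, rfl⟩ := hz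
    obtain ⟨w, hw, rfl⟩ := hw
    exact (R.2 hz hw).symm⟩

lemma PartialIsometry.exists_insert_left (hA : ∀ x y : A, dist x y ∈ J) (hB : UrysohnLike J B)
    (R : PartialIsometry A B) (a : A) : ∃ S : PartialIsometry A B, R ≤ S ∧ ∃ b, (a, b) ∈ S.1 := by
  classical
  obtain ⟨b, hb⟩ := hB.exists_dist_eq (fun z : R.1 => z.1.2) (fun z : R.1 => dist z.1.1 a)
    (fun z w => by
      rw [← R.2 z.2 w.2]
      exact ⟨by linarith [dist_triangle z.1.1 w.1.1 a], dist_triangle_right _ _ _⟩)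
    fun z => hA _ _
  have hb' : ∀ z ∈ R.1, dist z.1 a = dist z.2 b := fun z hz => by
    rw [dist_comm z.2]
    exact (hb ⟨z, hz⟩).symm
  refine ⟨⟨insert (a, b) R.1, fun z hz w hw => ?_⟩, Finset.subset_insert _ _, b,
    Finset.mem_insert_self _ _⟩
  simp only [Finset.coe_insert, mem_insert_iff, Finset.mem_coe] at hz hw
  rcases hz with rfl | hz <;> rcases hw with rfl | hw
  · simp
  · rw [dist_comm, hb' _ hw, dist_comm]
  · exact hb' _ hz
  · exact R.2 hz hw

lemma PartialIsometry.exists_insert_right (hA : UrysohnLike J A) (hB : ∀ x y : B, dist x y ∈ J)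
    (R : PartialIsometry A B) (b : B) : ∃ S : PartialIsometry A B, R ≤ S ∧ ∃ a, (a, b) ∈ S.1 := by
  classical
  obtain ⟨S, hRS, a, ha⟩ := exists_insert_left hB hA R.swap b
  refine ⟨S.swap, fun z hz => ?_, a, Finset.mem_image_of_mem Prod.swap ha⟩
  exact Finset.mem_image.2 ⟨z.swap, hRS (Finset.mem_image_of_mem _ hz), by simp⟩

/-- Every finite partial isometry between two complete separable `UrysohnLike` spaces extends to an
isometry between them. -/
lemma UrysohnLike.exists_isometryEquiv [CompleteSpace A] [CompleteSpace B]
    [TopologicalSpace.SeparableSpace A] [TopologicalSpace.SeparableSpace B]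
    (hA : UrysohnLike J A) (hB : UrysohnLike J B) (R : PartialIsometry A B) :
    ∃ e : A ≃ᵢ B, ∀ z ∈ R.1, e z.1 = z.2 := by
  obtain ⟨s, hsc, hsd⟩ := TopologicalSpace.exists_countable_dense A
  obtain ⟨t, htc, htd⟩ := TopologicalSpace.exists_countable_dense B
  have := hsc.to_subtype
  have := htc.to_subtype
  let _ := Encodable.ofCountable s
  let _ := Encodable.ofCountable t
  -- Meeting these countably many cofinal sets puts every point of `s` in the domain and every point
  -- of `t` in the range.
  let D : s ⊕ t → Order.Cofinal (PartialIsometry A B) := Sum.elim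
    (fun a => ⟨{S | ∃ b, (a.1, b) ∈ S.1}, fun S => by
      obtain ⟨T, h1, h2⟩ := S.exists_insert_left hA.dist_mem hB a.1
      exact ⟨T, h2, h1⟩⟩)
    (fun b => ⟨{S | ∃ a, (a, b.1) ∈ S.1}, fun S => by
      obtain ⟨T, h1, h2⟩ := S.exists_insert_right hA hB.dist_mem b.1
      exact ⟨T, h2, h1⟩⟩)
  let I := Order.idealOfCofinals R D
  let W : Set (A × B) := {z | ∃ S ∈ I, z ∈ S.1}
  have hW : IsIsometricRel W := by
    rintro z ⟨S, hS, hz⟩ w ⟨T, hT, hw⟩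
    obtain ⟨V, -, hSV, hTV⟩ := I.directed S hS T hT
    exact V.2 (hSV hz) (hTV hw)
  obtain ⟨e, he⟩ := hW.exists_isometryEquiv
    (hsd.mono fun a ha => by
      obtain ⟨S, ⟨b, hb⟩, hS⟩ := Order.cofinal_meets_idealOfCofinals R D (Sum.inl ⟨a, ha⟩)
      exact ⟨(a, b), ⟨S, hS, hb⟩, rfl⟩)
    (htd.mono fun b hb => by
      obtain ⟨S, ⟨a, ha⟩, hS⟩ := Order.cofinal_meets_idealOfCofinals R D (Sum.inr ⟨b, hb⟩)
      exact ⟨(a, b), ⟨S, hS, ha⟩, rfl⟩)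
  exact ⟨e, fun z hz => he z ⟨R, Order.mem_idealOfCofinals R D, hz⟩⟩

end Extension

/-! ### From approximate to exact realization -/

section Approximation

variable {ι Y : Type*} [MetricSpace Y] {J : Set ℝ}

/-- The largest error at `y` is the least distance from `y` that a realization of `f` could have.
Its consistency lets a near realization be corrected by a move no larger than its error. -/
lemma IsKatetov.option_iSup [Finite ι] {p : ι → Y} {f : ι → ℝ} (h : IsKatetov p f) (y : Y) :
    IsKatetov (fun o : Option ι => o.elim y p)
      (fun o => o.elim (⨆ i, |dist y (p i) - f i|) f) := by
  have hle : ∀ i, |dist y (p i) - f i| ≤ ⨆ i, |dist y (p i) - f i| := fun i =>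
    le_ciSup (f := fun i => |dist y (p i) - f i|) (finite_range _).bddAbove i
  refine h.option (Real.iSup_nonneg fun i => abs_nonneg _) (fun i => ?_) (fun i => ?_) fun i => ?_
  · have := (abs_le.1 (hle i)).1
    linarith [dist_comm y (p i)]
  · refine Real.iSup_le (fun j => ?_) (add_nonneg (h.nonneg i) dist_nonneg)
    rw [abs_le]
    constructor
    · linarith [(h j i).1, dist_triangle (p j) y (p i), dist_comm y (p i), dist_comm y (p j)]
    · linarith [(h i j).2, dist_triangle y (p i) (p j), dist_comm y (p i)]
  · have := (abs_le.1 (hle i)).2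
    linarith [dist_comm y (p i)]

lemma UrysohnLike.exists_dist_eq_near [Finite ι] (hJ : IsLowerSet J) (h1 : 1 ∈ J)
    (hY : UrysohnLike J Y) {p : ι → Y} {f : ι → ℝ} (hf : IsKatetov p f) (hfJ : ∀ i, f i ∈ J)
    {y : Y} {η : ℝ} (hη0 : 0 ≤ η) (hη1 : η ≤ 1) (hy : ∀ i, |dist y (p i) - f i| ≤ η) :
    ∃ z, (∀ i, dist z (p i) = f i) ∧ dist z y ≤ η := by
  have hs : ⨆ i, |dist y (p i) - f i| ≤ η := Real.iSup_le hy hη0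
  obtain ⟨z, hz⟩ := hY.exists_dist_eq _ _ (hf.option_iSup y) (by
    rintro (_ | i)
    · exact hJ (hs.trans hη1) h1
    · exact hfJ i)
  exact ⟨z, fun i => hz (some i), (hz none).trans_le hs⟩

/-- Each approximation also prescribes the distance to the previous one to be the error of the
latter, so halving the errors yields a Cauchy sequence. -/
lemma urysohnLike_of_approx [CompleteSpace Y] (hJ : IsLowerSet J) (h1 : 1 ∈ J)
    (hd : ∀ x y : Y, dist x y ∈ J)
    (h : ∀ (n : ℕ) (p : Fin n → Y) (f : Fin n → ℝ), IsKatetov p f → (∀ i, f i ∈ J) →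
      ∀ ε > 0, ∃ y, ∀ i, |dist y (p i) - f i| ≤ ε) : UrysohnLike J Y := by
  refine ⟨hd, fun n p f hf hfJ => ?_⟩
  have step : ∀ (k : ℕ) (y : {y : Y // ∀ i, |dist y (p i) - f i| ≤ (1 / 2 : ℝ) ^ k}),
      ∃ z : {y : Y // ∀ i, |dist y (p i) - f i| ≤ (1 / 2 : ℝ) ^ (k + 1)},
        dist y.1 z.1 ≤ 2 * (1 / 2 : ℝ) ^ k := by
    rintro k ⟨y, hy⟩
    have hs : ⨆ i, |dist y (p i) - f i| ≤ (1 / 2 : ℝ) ^ k := Real.iSup_le hy (by positivity)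
    have hk := hf.option_iSup y
    obtain ⟨m, ⟨e⟩⟩ := Finite.exists_equiv_fin (Option (Fin n))
    obtain ⟨z, hz⟩ := h m _ _ (hk.comp e.symm) (by
      intro i
      change (e.symm i).elim _ f ∈ J
      cases e.symm i with
      | none => exact hJ (hs.trans (pow_le_one₀ (by norm_num) (by norm_num))) h1
      | some i => exact hfJ i) ((1 / 2 : ℝ) ^ (k + 1)) (by positivity)
    have hz' : ∀ o : Option (Fin n), |dist z (o.elim y p) -
        o.elim (⨆ i, |dist y (p i) - f i|) f| ≤ (1 / 2 : ℝ) ^ (k + 1) := fun o => by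
      simpa using hz (e o)
    refine ⟨⟨z, fun i => hz' (some i)⟩, ?_⟩
    have h2 := (abs_le.1 (hz' none)).2
    simp only [Option.elim] at h2
    rw [pow_succ] at h2
    rw [dist_comm]
    have : (0 : ℝ) < (1 / 2) ^ k := by positivity
    change dist z y ≤ _
    linarith
  choose next hnext using step
  obtain ⟨y₀, hy₀⟩ := h n p f hf hfJ 1 one_pos
  let s : ∀ k : ℕ, {y : Y // ∀ i, |dist y (p i) - f i| ≤ (1 / 2 : ℝ) ^ k} :=
    fun k => Nat.rec ⟨y₀, by simpa using hy₀⟩ next k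
  have hc : CauchySeq fun k => (s k).1 :=
    cauchySeq_of_le_geometric (1 / 2) 2 (by norm_num) fun k => hnext k (s k)
  obtain ⟨y, hy⟩ := cauchySeq_tendsto_of_complete hc
  refine ⟨y, fun i => ?_⟩
  have l1 : Tendsto (fun k => |dist (s k).1 (p i) - f i|) atTop (𝓝 |dist y (p i) - f i|) :=
    ((hy.dist tendsto_const_nhds).sub_const _).abs
  have l2 : Tendsto (fun k : ℕ => (1 / 2 : ℝ) ^ k) atTop (𝓝 0) :=
    tendsto_pow_atTop_nhds_zero_of_lt_one (by norm_num) (by norm_num)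
  have := le_of_tendsto_of_tendsto' l1 l2 fun k => (s k).2 i
  exact sub_eq_zero.1 (abs_nonpos_iff.1 this)

end Approximation

/-! ### Subsets that are Urysohn relative to the ambient space -/

/-- Every Katetov function compatible with the distance to `A` is approximately realized in `A`. -/
def IsRelativelyUrysohn {X : Type*} [MetricSpace X] (J : Set ℝ) (A : Set X) : Prop :=
  ∀ (n : ℕ) (p : Fin n → X) (f : Fin n → ℝ), IsKatetov p f → (∀ i, f i ∈ J) →
    (∀ i, Metric.infDist (p i) A < f i) → ∀ ε > 0, ∃ a ∈ A, ∀ i, |dist a (p i) - f i| < ε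

section Relative

variable {X : Type*} [MetricSpace X] {J : Set ℝ} {A : Set X}

lemma IsRelativelyUrysohn.exists_mem (h : IsRelativelyUrysohn J A) {ι : Type*} [Finite ι]
    {p : ι → X} {f : ι → ℝ} (hf : IsKatetov p f) (hfJ : ∀ i, f i ∈ J)
    (hA : ∀ i, Metric.infDist (p i) A < f i) {ε : ℝ} (hε : 0 < ε) :
    ∃ a ∈ A, ∀ i, |dist a (p i) - f i| < ε := by
  obtain ⟨n, ⟨e⟩⟩ := Finite.exists_equiv_fin ι
  obtain ⟨a, ha, h⟩ := h n _ _ (hf.comp e.symm) (fun i => hfJ _) (fun i => hA _) ε hε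
  exact ⟨a, ha, fun i => by simpa using h (e i)⟩

lemma IsRelativelyUrysohn.urysohnLike [CompleteSpace X] (hJ : IsLowerSet J) (h1 : 1 ∈ J)
    (hd : ∀ x y : X, dist x y ∈ J) (hA : IsClosed A) (h : IsRelativelyUrysohn J A) :
    UrysohnLike J A := by
  have : CompleteSpace A := hA.completeSpace_coe
  refine urysohnLike_of_approx hJ h1 (fun x y => hd x y) fun n p f hf hfJ ε hε => ?_
  obtain ⟨M, hM, hM1, hMle⟩ := exists_mem_forall_le (ι := Fin n ⊕ Fin n × Fin n) h1
    (Sum.elim f fun i => dist (p i.1) (p i.2)) (by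
      rintro (i | i)
      · exact hfJ i
      · exact hd _ _)
  have hMf : ∀ i, f i ≤ M := fun i => hMle (Sum.inl i)
  have hMd : ∀ i j, dist (p i) (p j) ≤ M := fun i j => hMle (Sum.inr (i, j))
  -- Raising `f` by `ε / 2` makes it strictly exceed the distance 0 to `A`; truncating at `M` keeps
  -- it in `J`.
  have hpos : ∀ i, 0 < min (f i + ε / 2) M := fun i =>
    lt_min (by linarith [hf.nonneg i]) (by linarith)
  obtain ⟨a, ha, h⟩ := h n (fun i => p i) (fun i => min (f i + ε / 2) M)
    (fun i j => by
      have hij := hf i j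
      rw [Subtype.dist_eq] at hij
      have hd0 := dist_nonneg (x := (p i : X)) (y := p j)
      constructor
      · rw [← min_add_add_right]
        exact min_le_min (by linarith) (by linarith)
      · have := hMd i j
        rw [Subtype.dist_eq] at this
        have h1 := hpos i
        have h2 := hpos j
        beta_reduce
        rcases min_choice (f i + ε / 2) M with h3 | h3 <;>
        rcases min_choice (f j + ε / 2) M with h4 | h4 <;> rw [h3, h4] <;>
        rw [h3] at h1 <;> rw [h4] at h2 <;> linarith)
    (fun i => hJ (min_le_right _ _) hM)
    (fun i => by rw [Metric.infDist_zero_of_mem (p i).2]; exact hpos i) (ε / 2) (by linarith)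
  refine ⟨⟨a, ha⟩, fun i => ?_⟩
  have hi := abs_lt.1 (h i)
  have h2 : f i ≤ min (f i + ε / 2) M := le_min (by linarith) (hMf i)
  have h3 : min (f i + ε / 2) M ≤ f i + ε / 2 := min_le_left _ _
  rw [Subtype.dist_eq, abs_le]
  constructor <;> simp only <;> linarith

/-- A point `x` close to a relatively Urysohn set `A` is not determined, up to `ε`, by the type of
points of `A` over any finite subset of `A`. -/
lemma IsRelativelyUrysohn.exists_dist_ne [CompleteSpace X] (hJ : IsLowerSet J) (h1 : 1 ∈ J)
    (hd : ∀ x y : X, dist x y ∈ J) (hA : IsClosed A) (h : IsRelativelyUrysohn J A)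
    {x : X} (hx0 : 0 < Metric.infDist x A) (hx : Metric.infDist x A < 1 / 2) (s : Finset A) :
    ∃ a b : A, (∀ c ∈ s, dist a c = dist b c) ∧ Metric.infDist x A / 2 < |dist x a - dist x b| := by
  set δ := Metric.infDist x A with hδ
  have hU := h.urysohnLike hJ h1 hd hA
  obtain ⟨D, hD, hD1, hDle⟩ := exists_mem_forall_le (ι := s ⊕ s × s) h1
    (Sum.elim (fun a => dist x a.1) fun i => dist i.1.1 i.2.1) (by
      rintro (i | i)
      · exact hd _ _
      · exact hd _ _)
  have hDx : ∀ i : s, dist x i.1 ≤ D := fun i => hDle (Sum.inl i)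
  have hDd : ∀ i j : s, dist i.1 j.1 ≤ D := fun i j => hDle (Sum.inr (i, j))
  have hδle : ∀ i : s, δ ≤ dist x i.1 := fun i => Metric.infDist_le_dist_of_mem i.1.2
  -- The value `D / 2` on `s` and `v` at `x` is consistent on this whole interval because `x` is at
  -- distance at least `δ` from `s`. The two endpoints give `a` and `b`.
  have key : ∀ v, D / 2 ≤ v → v ≤ D / 2 + δ → ∃ a : A, (∀ c ∈ s, dist a c = D / 2) ∧
      |dist x a - v| < δ / 4 := by
    intro v hv1 hv2
    have hK : IsKatetov (fun i : s => i.1) (fun _ => D / 2) := fun i j =>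
      ⟨by linarith [dist_nonneg (x := i.1) (y := j.1)], by linarith [hDd i j]⟩
    have hK' : IsKatetov (fun i : s => (i.1 : X)) (fun _ => D / 2) := hK
    obtain ⟨a, haA, ha⟩ := h.exists_mem (hK'.option (y := x) (c := v) (by linarith)
      (fun i => by linarith [dist_nonneg (x := (i.1 : X)) (y := x)])
      (fun i => by linarith [hδle i, dist_comm x i.1])
      (fun i => by linarith [hDx i, dist_comm x i.1]))
      (by
        rintro (_ | i)
        · exact hJ (show v ≤ D by linarith) hD
        · exact hJ (show D / 2 ≤ D by linarith) hD)
      (by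
        rintro (_ | i)
        · change δ < v
          linarith
        · change Metric.infDist (i.1 : X) A < D / 2
          rw [Metric.infDist_zero_of_mem i.1.2]
          linarith)
      (ε := δ / 8) (by linarith)
    -- A move of at most `δ / 8` inside `A` makes the distances to `s` exact.
    obtain ⟨b, hb, hba⟩ := hU.exists_dist_eq_near hJ h1 hK
      (fun _ => hJ (show D / 2 ≤ D by linarith) hD) (y := ⟨a, haA⟩) (η := δ / 8) (by linarith)
      (by linarith) (fun i => (ha (some i)).le)
    refine ⟨b, fun c hc => hb ⟨c, hc⟩, ?_⟩
    have h3 := abs_lt.1 (ha none)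
    simp only [Option.elim] at h3
    rw [Subtype.dist_eq] at hba
    simp only at hba
    rw [abs_lt]
    constructor
    · linarith [dist_triangle a b x, dist_comm x b, dist_comm a b]
    · linarith [dist_triangle (b : X) a x, dist_comm x b]
  obtain ⟨a, ha, hav⟩ := key (D / 2) le_rfl (by linarith)
  obtain ⟨b, hb, hbv⟩ := key (D / 2 + δ) (by linarith) le_rfl
  refine ⟨a, b, fun c hc => (ha c hc).trans (hb c hc).symm, ?_⟩
  rw [abs_lt] at hav hbv
  rw [abs_sub_comm]
  exact lt_of_lt_of_le (by linarith) (le_abs_self _)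

end Relative

lemma exists_finset_forall_dist_lt_of_isInducing {Z ι Y : Type*} [TopologicalSpace Z]
    [PseudoMetricSpace Y] {e : Z → ι → Y} (he : IsInducing e) {O : Set Z} (hO : IsOpen O) {z : Z}
    (hz : z ∈ O) :
    ∃ s : Finset ι, ∃ η > 0, ∀ w, (∀ q ∈ s, dist (e w q) (e z q) < η) → w ∈ O := by
  obtain ⟨V, hV, rfl⟩ := he.isOpen_iff.1 hO
  obtain ⟨s, v, hv, hsv⟩ := isOpen_pi_iff.1 hV (e z) hz
  have h : ∀ q ∈ s, ∀ᶠ η : ℝ in 𝓝[>] 0, Metric.ball (e z q) η ⊆ v q := by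
    intro q hq
    obtain ⟨r, hr, hrv⟩ := Metric.isOpen_iff.1 (hv q hq).1 _ (hv q hq).2
    filter_upwards [Ioc_mem_nhdsGT hr] with η hη
    exact (Metric.ball_subset_ball hη.2).trans hrv
  obtain ⟨η, hη, hη0⟩ := (((Filter.eventually_all_finset s).2 h).and self_mem_nhdsWithin).exists
  exact ⟨s, η, hη0, fun w hw => hsv fun q hq => hη q hq (hw q hq)⟩

/-! ### Generic closed sets in the Wijsman topology -/

section Hyperspace

variable {X : Type u} [MetricSpace X] {J : Set ℝ}

lemma Hyperspace.isInducing_infDist :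
    IsInducing fun (F : Hyperspace X) (x : X) => Metric.infDist x F.carrier := by
  constructor
  change wijsmanTopology X = TopologicalSpace.induced _ (⨅ x, TopologicalSpace.induced _ _)
  rw [induced_iInf]
  simp only [induced_compose]
  rfl

lemma Hyperspace.continuous_infDist (x : X) :
    Continuous fun F : Hyperspace X => Metric.infDist x F.carrier :=
  (continuous_apply x).comp isInducing_infDist.continuous

lemma Hyperspace.isOpen_setOf_inter_nonempty {O : Set X} (hO : IsOpen O) :
    IsOpen {F : Hyperspace X | (F.carrier ∩ O).Nonempty} := by
  have : {F : Hyperspace X | (F.carrier ∩ O).Nonempty} =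
      ⋃ (y : X) (r : ℝ) (_ : Metric.ball y r ⊆ O), {F | Metric.infDist y F.carrier < r} := by
    ext F
    simp only [mem_ofPred_eq, mem_iUnion, exists_prop]
    constructor
    · rintro ⟨y, hyF, hyO⟩
      obtain ⟨r, hr, hrO⟩ := Metric.isOpen_iff.1 hO y hyO
      exact ⟨y, r, hrO, by rwa [Metric.infDist_zero_of_mem hyF]⟩
    · rintro ⟨y, r, hrO, h⟩
      obtain ⟨z, hz, hyz⟩ := (Metric.infDist_lt_iff F.nonempty_carrier).1 h
      exact ⟨z, hz, hrO (by rwa [Metric.mem_ball, dist_comm])⟩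
  rw [this]
  exact isOpen_iUnion fun y => isOpen_iUnion fun r => isOpen_iUnion fun _ =>
    isOpen_lt (continuous_infDist y) continuous_const

lemma Hyperspace.dense_setOf_realize (hJ : IsLowerSet J) (h1 : 1 ∈ J) (hX : UrysohnLike J X)
    {ι : Type*} [Finite ι] {p : ι → X} {f : ι → ℝ} (hf : IsKatetov p f) (hfJ : ∀ i, f i ∈ J)
    {ε : ℝ} (hε : 0 < ε) :
    Dense {F : Hyperspace X | (∃ i, f i < Metric.infDist (p i) F.carrier) ∨
      ∃ a ∈ F.carrier, ∀ i, |dist a (p i) - f i| < ε} := by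
  rw [dense_iff_inter_open]
  rintro O hO ⟨A, hA⟩
  by_cases hlt : ∃ i, f i < Metric.infDist (p i) A.carrier
  · exact ⟨A, hA, Or.inl hlt⟩
  push Not at hlt
  obtain ⟨s, η, hη, hs⟩ := exists_finset_forall_dist_lt_of_isInducing isInducing_infDist hO hA
  obtain ⟨a₀, ha₀⟩ := A.nonempty_carrier
  let r : ι ⊕ s → X := Sum.elim p Subtype.val
  obtain ⟨M, hM, hM1, hMle⟩ := exists_mem_forall_le
    (ι := ι ⊕ ((ι ⊕ s) × (ι ⊕ s)) ⊕ s) h1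
    (Sum.elim f (Sum.elim (fun k => dist (r k.1) (r k.2)) fun q => dist q.1 a₀)) (by
      rintro (i | i | i)
      · exact hfJ i
      · exact hX.dist_mem _ _
      · exact hX.dist_mem _ _)
  obtain ⟨a, ha⟩ := hX.exists_dist_eq r (fun k => katetovExt p f M (r k))
    (isKatetov_katetovExt hf (by linarith) r fun j k => hMle (Sum.inr (Sum.inl (j, k))))
    fun k => hJ (katetovExt_le_bound _) hM
  refine ⟨⟨A.carrier ∪ {a}, A.isClosed_carrier.union isClosed_singleton, A.nonempty_carrier.inl⟩,
    hs _ fun q hq => ?_, Or.inr ⟨a, Or.inr rfl, fun i => ?_⟩⟩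
  -- Since `f` is at least the distance to `A`, so is its extension at `q`; `M` was chosen above
  -- `dist q a₀` so that the cap does no harm.
  · have hqa : Metric.infDist q A.carrier ≤ dist a q := by
      refine le_of_le_of_eq ?_ (ha (Sum.inr ⟨q, hq⟩)).symm
      refine le_katetovExt ?_ fun i => ?_
      · exact (Metric.infDist_le_dist_of_mem ha₀).trans (hMle (Sum.inr (Sum.inr ⟨q, hq⟩)))
      · refine Metric.infDist_le_infDist_add_dist.trans (add_le_add (hlt i) ?_)
        exact (dist_comm _ _).le
    have : Metric.infDist q (A.carrier ∪ {a}) = Metric.infDist q A.carrier := by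
      refine le_antisymm (Metric.infDist_le_infDist_of_subset subset_union_left ⟨a₀, ha₀⟩) ?_
      rw [Metric.le_infDist ⟨a, Or.inr rfl⟩]
      rintro y (hy | rfl)
      · exact Metric.infDist_le_dist_of_mem hy
      · rwa [dist_comm]
    rwa [this, dist_self]
  · have := ha (Sum.inl i)
    have h2 : katetovExt p f M (p i) = f i := katetovExt_apply hf (hMle (Sum.inl i))
    simp only [r, Sum.elim_inl, h2] at this
    simpa [this] using hε

lemma Hyperspace.isOpen_setOf_realize {ι : Type*} [Finite ι] (p : ι → X) (f : ι → ℝ) (ε : ℝ) :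
    IsOpen {F : Hyperspace X | (∃ i, f i < Metric.infDist (p i) F.carrier) ∨
      ∃ a ∈ F.carrier, ∀ i, |dist a (p i) - f i| < ε} := by
  rw [ofPred_or]
  refine IsOpen.union ?_ ?_
  · rw [ofPred_exists]
    exact isOpen_iUnion fun i => isOpen_lt continuous_const (continuous_infDist _)
  · refine isOpen_setOf_inter_nonempty (O := {a | ∀ i, |dist a (p i) - f i| < ε}) ?_
    rw [ofPred_forall]
    exact isOpen_iInter_of_finite fun i => isOpen_lt (by fun_prop) continuous_const

lemma eventually_isRelativelyUrysohn [TopologicalSpace.SeparableSpace X] (hJ : IsLowerSet J)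
    (h1 : 1 ∈ J) (hX : UrysohnLike J X) :
    ∀ᶠ F in residual (Hyperspace X), IsRelativelyUrysohn J F.carrier := by
  have : SecondCountableTopology X := UniformSpace.secondCountable_of_separable X
  simp only [IsRelativelyUrysohn]
  rw [eventually_countable_forall]
  intro n
  obtain ⟨C, hCc, hCd⟩ := TopologicalSpace.exists_countable_dense
    {c : (Fin n → X) × (Fin n → ℝ) // IsKatetov c.1 c.2 ∧ ∀ i, c.2 i ∈ J}
  have key : ∀ᶠ F in residual (Hyperspace X), ∀ c ∈ C, ∀ k : ℕ,
      (∃ i, c.1.2 i < Metric.infDist (c.1.1 i) F.carrier) ∨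
        ∃ a ∈ F.carrier, ∀ i, |dist a (c.1.1 i) - c.1.2 i| < 1 / ((k : ℝ) + 1) := by
    rw [eventually_countable_ball hCc]
    intro c _
    rw [eventually_countable_forall]
    intro k
    exact residual_of_dense_open (Hyperspace.isOpen_setOf_realize _ _ _)
      (Hyperspace.dense_setOf_realize hJ h1 hX c.2.1 c.2.2 (by positivity))
  filter_upwards [key] with F hF p f hf hfJ hlt ε hε
  obtain ⟨k, hk⟩ := exists_nat_one_div_lt (show 0 < ε / 3 by linarith)
  -- The strict inequality with the distance to `F` makes `V` open, so it meets the countable dense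
  -- set `C`.
  let V : Set {c : (Fin n → X) × (Fin n → ℝ) // IsKatetov c.1 c.2 ∧ ∀ i, c.2 i ∈ J} :=
    {c | ∀ i, Metric.infDist (c.1.1 i) F.carrier < c.1.2 i ∧ dist (c.1.1 i) (p i) < ε / 3 ∧
      |c.1.2 i - f i| < ε / 3}
  have hV : IsOpen V := by
    simp only [V, ofPred_forall]
    refine isOpen_iInter_of_finite fun i => IsOpen.and (isOpen_lt ?_ (by fun_prop))
      (IsOpen.and (isOpen_lt (by fun_prop) continuous_const)
        (isOpen_lt (by fun_prop) continuous_const))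
    exact (Metric.continuous_infDist_pt _).comp
      ((continuous_apply i).comp (continuous_fst.comp continuous_subtype_val))
  obtain ⟨c, hcV, hcC⟩ := hCd.inter_open_nonempty V hV
    ⟨⟨(p, f), hf, hfJ⟩, fun i => ⟨hlt i, by simp only [dist_self]; linarith, by simp; linarith⟩⟩
  rcases hF c hcC k with ⟨i, hi⟩ | ⟨a, ha, hai⟩
  · exact absurd hi (hcV i).1.not_gt
  · refine ⟨a, ha, fun i => ?_⟩
    have h2 := abs_lt.1 (hai i)
    obtain ⟨-, h3, h4⟩ := hcV i
    rw [abs_lt] at h4 ⊢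
    constructor
    · linarith [dist_triangle a (p i) (c.1.1 i), dist_comm (p i) (c.1.1 i)]
    · linarith [dist_triangle a (c.1.1 i) (p i)]

lemma UrysohnLike.exists_infDist_eq (hJ : IsLowerSet J) (h1 : 1 ∈ J) (hX : UrysohnLike J X)
    {A : Set X} (hA : A.Finite) (hne : A.Nonempty) : ∃ x, Metric.infDist x A = 1 / 4 := by
  obtain ⟨a₀, ha₀⟩ := hne
  have := hA.to_subtype
  obtain ⟨M, hM, hM1, hMle⟩ := exists_mem_forall_le (ι := A × A) h1
    (fun k => dist k.1.1 k.2.1) fun k => hX.dist_mem _ _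
  have hf : IsKatetov (fun _ : Unit => a₀) fun _ => 1 / 4 := fun i j => by norm_num
  obtain ⟨x, hx⟩ := hX.exists_dist_eq (Subtype.val : A → X) (fun a => katetovExt
    (fun _ : Unit => a₀) (fun _ => 1 / 4) M a)
    (isKatetov_katetovExt hf (by linarith) _ fun j k => hMle (j, k))
    fun k => hJ (katetovExt_le_bound _) hM
  refine ⟨x, le_antisymm ?_ ?_⟩
  · refine (Metric.infDist_le_dist_of_mem ha₀).trans ?_
    rw [hx ⟨a₀, ha₀⟩]
    exact (katetovExt_le _ ()).trans (by simp)
  · rw [Metric.le_infDist ⟨a₀, ha₀⟩]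
    intro y hy
    rw [hx ⟨y, hy⟩]
    exact le_katetovExt (by linarith) fun _ => le_add_of_nonneg_right dist_nonneg

lemma eventually_exists_infDist (hJ : IsLowerSet J) (h1 : 1 ∈ J) (hX : UrysohnLike J X) :
    ∀ᶠ F in residual (Hyperspace X),
      ∃ x, 0 < Metric.infDist x F.carrier ∧ Metric.infDist x F.carrier < 1 / 2 := by
  refine residual_of_dense_open ?_ ?_
  · rw [ofPred_exists]
    exact isOpen_iUnion fun x => (isOpen_lt continuous_const (Hyperspace.continuous_infDist x)).inter
      (isOpen_lt (Hyperspace.continuous_infDist x) continuous_const)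
  rw [dense_iff_inter_open]
  rintro O hO ⟨A, hA⟩
  obtain ⟨s, η, hη, hs⟩ :=
    exists_finset_forall_dist_lt_of_isInducing Hyperspace.isInducing_infDist hO hA
  obtain ⟨a₀, ha₀⟩ := A.nonempty_carrier
  -- Finite subsets of `A` containing near-nearest points to `s` are Wijsman-close to `A`, and a
  -- finite set always leaves room for a point at distance 1/4.
  choose g hgA hg using fun q : X => (Metric.infDist_lt_iff A.nonempty_carrier).1
    (lt_add_of_pos_right (Metric.infDist q A.carrier) hη)
  have hfin : (insert a₀ (g '' s)).Finite := (s.finite_toSet.image g).insert a₀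
  obtain ⟨x, hx⟩ := hX.exists_infDist_eq hJ h1 hfin (insert_nonempty _ _)
  refine ⟨⟨insert a₀ (g '' s), hfin.isClosed, insert_nonempty _ _⟩, hs _ fun q hq => ?_, x, ?_⟩
  · have h2 : Metric.infDist q A.carrier ≤ Metric.infDist q (insert a₀ (g '' s)) := by
      refine Metric.infDist_le_infDist_of_subset ?_ (insert_nonempty _ _)
      rintro y (rfl | ⟨z, -, rfl⟩)
      · exact ha₀
      · exact hgA z
    have h3 : Metric.infDist q (insert a₀ (g '' s)) ≤ dist q (g q) :=
      Metric.infDist_le_dist_of_mem (Or.inr ⟨q, hq, rfl⟩)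
    rw [Real.dist_eq, abs_lt]
    constructor <;> linarith [hg q]
  · simp only [hx]
    norm_num

end Hyperspace

/-! ### Generic isometries do not extend -/

section Isometries

variable {X : Type u} [MetricSpace X] {J : Set ℝ}

lemma isInducing_isometryEquiv_coe (A B : Type u) [MetricSpace A] [MetricSpace B] :
    IsInducing fun f : A ≃ᵢ B => (f : A → B) := ⟨rfl⟩

lemma eventually_not_extends [CompleteSpace X] [TopologicalSpace.SeparableSpace X]
    (hJ : IsLowerSet J) (h1 : 1 ∈ J) (hd : ∀ x y : X, dist x y ∈ J) {A B : Set X}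
    (hA : IsClosed A) (hU : IsRelativelyUrysohn J A)
    (hx : ∃ x, 0 < Metric.infDist x A ∧ Metric.infDist x A < 1 / 2) :
    ∀ᶠ f in residual (A ≃ᵢ B), ¬ Extends f := by
  have : SecondCountableTopology X := UniformSpace.secondCountable_of_separable X
  have : CompleteSpace A := hA.completeSpace_coe
  obtain ⟨x, hx0, hx1⟩ := hx
  set δ := Metric.infDist x A with hδ
  have hL := hU.urysohnLike hJ h1 hd hA
  obtain ⟨D, hDc, hDd⟩ := TopologicalSpace.exists_countable_dense X
  have key : ∀ᶠ f in residual (A ≃ᵢ B), ∀ y ∈ D, ¬ ∀ a : A, |dist x a - dist y (f a)| ≤ δ / 4 := by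
    rw [eventually_countable_ball hDc]
    intro y _
    refine residual_of_dense_open ?_ ?_
    · rw [← compl_ofPred, isOpen_compl_iff, ofPred_forall]
      refine isClosed_iInter fun a => isClosed_le ?_ continuous_const
      have hc : Continuous fun f : A ≃ᵢ B => f a :=
        (continuous_apply a).comp (isInducing_isometryEquiv_coe A B).continuous
      exact (continuous_const.sub (continuous_const.dist
        (continuous_subtype_val.comp hc))).abs
    · rw [dense_iff_inter_open]
      rintro O hO ⟨f, hf⟩
      obtain ⟨s, η, hη, hs⟩ := exists_finset_forall_dist_lt_of_isInducing
        (isInducing_isometryEquiv_coe A B) hO hf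
      obtain ⟨a, b, hab, hne⟩ := hU.exists_dist_ne hJ h1 hd hA hx0 hx1 s
      classical
      obtain ⟨e, he⟩ := hL.exists_isometryEquiv hL
        ⟨insert (b, a) (s.image fun c => (c, c)), by
          intro z hz w hw
          simp only [Finset.coe_insert, Finset.coe_image, mem_insert_iff, mem_image,
            Finset.mem_coe] at hz hw
          rcases hz with rfl | ⟨c, hc, rfl⟩ <;> rcases hw with rfl | ⟨c', hc', rfl⟩
          · simp
          · exact (hab c' hc').symm
          · simp only [dist_comm c]
            exact (hab c hc).symm
          · rfl⟩
      have heb : e b = a := he (b, a) (Finset.mem_insert_self _ _)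
      have hes : ∀ c ∈ s, e c = c := fun c hc =>
        he (c, c) (Finset.mem_insert_of_mem (Finset.mem_image_of_mem _ hc))
      by_cases hfa : ∀ a : A, |dist x a - dist y (f a)| ≤ δ / 4
      -- The composite agrees with `f` on `s`, hence stays in `O`. If it were also bad, `d(y, f a)`
      -- would be within `δ / 4` of both `d(x, a)` and `d(x, b)`.
      · refine ⟨e.trans f, hs _ fun c hc => ?_, fun hg => ?_⟩
        · simpa [hes c hc] using hη
        · have h2 := abs_le.1 (hfa a)
          have h3 := hg b
          rw [IsometryEquiv.trans_apply, heb, abs_le] at h3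
          refine absurd hne (not_lt.2 (abs_le.2 ⟨?_, ?_⟩)) <;> linarith
      · exact ⟨f, hf, hfa⟩
  filter_upwards [key] with f hf
  rintro ⟨φ, hφ⟩
  obtain ⟨y, hy, hyD⟩ := hDd.inter_open_nonempty (Metric.ball (φ x) (δ / 4)) Metric.isOpen_ball
    ⟨φ x, Metric.mem_ball_self (by linarith)⟩
  refine hf y hyD fun a => ?_
  rw [← φ.dist_eq x a, hφ]
  exact (abs_dist_sub_le _ _ _).trans ((dist_comm _ _).trans_le (Metric.mem_ball.1 hy).le)

lemma generic_isometries_do_not_extend [CompleteSpace X] [TopologicalSpace.SeparableSpace X]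
    (hJ : IsLowerSet J) (h1 : 1 ∈ J) (hX : UrysohnLike J X) :
    (∀ᶠ F in residual (Hyperspace X), ∀ᶠ f in residual (F.carrier ≃ᵢ F.carrier), ¬ Extends f) ∧
    (∀ᶠ P in residual (Hyperspace X × Hyperspace X),
      Nonempty (P.1.carrier ≃ᵢ P.2.carrier) ∧
      ∀ᶠ f in residual (P.1.carrier ≃ᵢ P.2.carrier), ¬ Extends f) := by
  have : SecondCountableTopology X := UniformSpace.secondCountable_of_separable X
  have hU := eventually_isRelativelyUrysohn hJ h1 hX
  have hI := eventually_exists_infDist hJ h1 hX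
  constructor
  · filter_upwards [hU, hI] with F h2 h3
    exact eventually_not_extends hJ h1 hX.dist_mem F.isClosed_carrier h2 h3
  · have hfst := tendsto_residual_of_isOpenMap (continuous_fst (X := Hyperspace X)
      (Y := Hyperspace X)) isOpenMap_fst
    have hsnd := tendsto_residual_of_isOpenMap (continuous_snd (X := Hyperspace X)
      (Y := Hyperspace X)) isOpenMap_snd
    filter_upwards [hfst.eventually hU, hfst.eventually hI, hsnd.eventually hU] with P h2 h3 h4
    refine ⟨?_, eventually_not_extends hJ h1 hX.dist_mem P.1.isClosed_carrier h2 h3⟩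
    have : CompleteSpace P.1.carrier := P.1.isClosed_carrier.completeSpace_coe
    have : CompleteSpace P.2.carrier := P.2.isClosed_carrier.completeSpace_coe
    obtain ⟨e, -⟩ := (h2.urysohnLike hJ h1 hX.dist_mem P.1.isClosed_carrier).exists_isometryEquiv
      (h4.urysohnLike hJ h1 hX.dist_mem P.2.isClosed_carrier) ⟨∅, by simp [IsIsometricRel]⟩
    exact ⟨e⟩

lemma IsUrysohnSpace.urysohnLike (h : IsUrysohnSpace X) : UrysohnLike univ X :=
  urysohnLike_of_universal (mem_univ _) (fun _ _ => mem_univ _) h.ultrahomogeneous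
    fun Y _ _ _ _ => h.universal Y

lemma IsUrysohnSphere.urysohnLike (h : IsUrysohnSphere X) : UrysohnLike (Iic 1) X :=
  urysohnLike_of_universal (mem_Iic.2 zero_le_one) h.dist_le_one h.ultrahomogeneous
    fun Y _ _ _ hY => h.universal Y hY

end Isometries

end UrysohnGeneric

theorem mainTheorem2 :
    (∀ (U : Type u) [MetricSpace U], UrysohnGeneric.IsUrysohnSpace U →
      (∀ᶠ F in residual (UrysohnGeneric.Hyperspace U),
        ∀ᶠ f in residual (F.carrier ≃ᵢ F.carrier), ¬ UrysohnGeneric.Extends f) ∧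
      (∀ᶠ P in residual (UrysohnGeneric.Hyperspace U × UrysohnGeneric.Hyperspace U),
        Nonempty (P.1.carrier ≃ᵢ P.2.carrier) ∧
        ∀ᶠ f in residual (P.1.carrier ≃ᵢ P.2.carrier), ¬ UrysohnGeneric.Extends f)) ∧
    (∀ (S : Type u) [MetricSpace S], UrysohnGeneric.IsUrysohnSphere S →
      (∀ᶠ F in residual (UrysohnGeneric.Hyperspace S),
        ∀ᶠ f in residual (F.carrier ≃ᵢ F.carrier), ¬ UrysohnGeneric.Extends f) ∧
      (∀ᶠ P in residual (UrysohnGeneric.Hyperspace S × UrysohnGeneric.Hyperspace S),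
        Nonempty (P.1.carrier ≃ᵢ P.2.carrier) ∧
        ∀ᶠ f in residual (P.1.carrier ≃ᵢ P.2.carrier), ¬ UrysohnGeneric.Extends f)) := by
  refine ⟨fun U _ hU => ?_, fun S _ hS => ?_⟩
  · have := hU.complete
    have := hU.separable
    exact UrysohnGeneric.generic_isometries_do_not_extend isLowerSet_univ (Set.mem_univ _)
      hU.urysohnLike
  · have := hS.complete
    have := hS.separable
    exact UrysohnGeneric.generic_isometries_do_not_extend (isLowerSet_Iic 1) (Set.mem_Iic.2 le_rfl)
      hS.urysohnLike
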